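/- Let $M$ be a smooth manifold, $\mathcal F$ a transversely oriented smooth foliation of codimension one on $M$, and $\phi=\{\phi^t\}_{t\in\mathbb R}$ a smooth flow on $M$ which is foliated (each $\phi^t$ maps leaves to leaves), with infinitesimal generator $Z$. A leaf $L$ is preserved if $\phi^t(L)=L$ for all $t$. For a foliated chart $(U,(x,y))$ around a point $p$ of a preserved leaf, with transverse coordinate $x$, let $\bar\phi$ be the local flow around $x(p)$ in $\mathbb R$ with $x\circ\phi^t=\bar\phi^t\circ x$ near $p$, for small $|t|$; it fixes $x(p)$. Assume that $\phi$ is transversely simple, that is, for every point $p$ of every preserved leaf, the tangent map of $\bar\phi^t$ at $x(p)$ is multiplication by $e^{\varkappa t}$ for some real $\varkappa\ne0$. Let $L$ be a leaf preserved by $\phi$. Then there is a unique real number $\varkappa_L\neq0$ such that the tangent map of $\bar\phi^t$ at $x(p)$ is multiplication by $e^{\varkappa_Lt}$ for all $p\in L$. For every $p\in L$, there are foliated charts $(U,(x,y))$ around $p$ with $x(p)=0$ in which the transverse vector field induced by $Z$ is $\varkappa_L\,x\,\partial_x$ (that is, $dx(Z)=\varkappa_L\,x$ on $U$). For every such chart,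 the holonomy group $\operatorname{Hol}(L,p)$, described in the transverse coordinate $x$, consists of germs at $0$ of (orientation-preserving) homotheties of $\mathbb R$: each of its elements is the germ at $0$ of $x\mapsto ax$ for some $a>0$. -/

import Mathlib

open Set Filter Topology
open scoped Manifold ContDiff

noncomputable section

/-- The model of a codimension one foliated chart: transverse coordinate `x ∈ ℝ`, leafwise
coordinates `y ∈ ℝⁿ`. -/
abbrev FolModel (n : ℕ) : Type := ℝ × EuclideanSpace ℝ (Fin n)

section Charts

variable {n : ℕ} {M : Type*} [TopologicalSpace M]

/-- Near every common point, the transverse coordinate of `e'` is a function of the transverse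
coordinate of `e`. -/
def TransverselyCompatible (e e' : OpenPartialHomeomorph M (FolModel n)) : Prop :=
  ∀ q ∈ e.source ∩ e'.source, ∃ h : ℝ → ℝ, ∀ᶠ z in 𝓝 q, (e' z).1 = h (e z).1

/-- `e` is a smooth chart of the `(n+1)`-manifold `M` whose image is the product of an open ball
(a bounded open interval) in `ℝ` and an open ball in `ℝⁿ`. -/
structure IsSmoothBoxChart [ChartedSpace (EuclideanSpace ℝ (Fin (n + 1))) M]
    (e : OpenPartialHomeomorph M (FolModel n)) : Prop where
  smooth : ContMDiffOn (𝓡 (n + 1)) 𝓘(ℝ, FolModel n) ∞ e e.source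
  smooth_symm : ContMDiffOn 𝓘(ℝ, FolModel n) (𝓡 (n + 1)) ∞ e.symm e.target
  box : ∃ (a r : ℝ) (b : EuclideanSpace ℝ (Fin n)) (s : ℝ),
    e.target = Metric.ball a r ×ˢ Metric.ball b s

end Charts

/-- A smooth foliation of codimension one (with leaves of dimension `n`) on a smooth manifold of
dimension `n + 1`, given by a foliated atlas. -/
structure Foliation (n : ℕ) (M : Type*) [TopologicalSpace M]
    [ChartedSpace (EuclideanSpace ℝ (Fin (n + 1))) M] where
  atlas : Set (OpenPartialHomeomorph M (FolModel n))
  chart_smooth : ∀ e ∈ atlas, IsSmoothBoxChart e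
  cover : ∀ p : M, ∃ e ∈ atlas, p ∈ e.source
  compat : ∀ e ∈ atlas, ∀ e' ∈ atlas, TransverselyCompatible e e'

namespace Foliation

variable {n : ℕ} {M : Type*} [TopologicalSpace M]
  [ChartedSpace (EuclideanSpace ℝ (Fin (n + 1))) M] (F : Foliation n M)

/-- The foliated charts of `F`: the charts of the maximal foliated atlas containing `F.atlas`. -/
structure IsFoliatedChart (e : OpenPartialHomeomorph M (FolModel n)) : Prop where
  box_chart : IsSmoothBoxChart e
  compat_left : ∀ a ∈ F.atlas, TransverselyCompatible a e
  compat_right : ∀ a ∈ F.atlas, TransverselyCompatible e a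

/-- The plaque of the chart `e` at height `x`. -/
def plaque (e : OpenPartialHomeomorph M (FolModel n)) (x : ℝ) : Set M :=
  {q | q ∈ e.source ∧ (e q).1 = x}

/-- The leaf topology on `M`, generated by all plaques of all foliated charts. -/
abbrev leafTopology : TopologicalSpace M :=
  TopologicalSpace.generateFrom
    {P | ∃ (e : OpenPartialHomeomorph M (FolModel n)) (x : ℝ),
      F.IsFoliatedChart e ∧ P = plaque e x}

/-- The leaf through `p`: its path component in the leaf topology. -/
def leaf (p : M) : Set M := @pathComponent M F.leafTopology p

/-- `L` is a leaf of `F`. -/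
def IsLeaf (L : Set M) : Prop := ∃ p : M, L = F.leaf p

/-- `F` is transversely orientable: there is a foliated atlas whose elementary holonomy
transformations preserve the orientation of `ℝ`. -/
def IsTransverselyOrientable : Prop :=
  ∃ A : Set (OpenPartialHomeomorph M (FolModel n)),
    (∀ e ∈ A, F.IsFoliatedChart e) ∧ (∀ p : M, ∃ e ∈ A, p ∈ e.source) ∧
    ∀ e ∈ A, ∀ e' ∈ A, ∀ q ∈ e.source ∩ e'.source,
      ∃ h : ℝ → ℝ, (∀ᶠ z in 𝓝 q, (e' z).1 = h (e z).1) ∧ 0 < deriv h (e q).1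

/-- The composite `g (m - 1) ∘ ⋯ ∘ g 1 ∘ g 0`. -/
def chainComp (g : ℕ → ℝ → ℝ) : ℕ → ℝ → ℝ
  | 0 => id
  | m + 1 => g m ∘ chainComp g m

/-- `γ` is the germinal holonomy, from the chart `e` around `p` to the chart `e'` around `q`, of
the path `c` from `p` to `q` in a leaf. There are a partition `0 = t₀ < ⋯ < t_{m+1} = 1` and
foliated charts `e = k₀, …, k_m = e'` such that `c` maps `[tᵢ, tᵢ₊₁]` into the domain of `kᵢ`; the
local transformation `gᵢ` is the elementary holonomy from `kᵢ` to `kᵢ₊₁` around `c (tᵢ₊₁)`, and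
`γ` is the germ of `g_{m-1} ∘ ⋯ ∘ g₀`. -/
def IsHolonomy {p q : M} (c : @Path M F.leafTopology p q)
    (e e' : OpenPartialHomeomorph M (FolModel n)) (γ : Germ (𝓝 (e p).1) ℝ) : Prop :=
  ∃ (m : ℕ) (t : ℕ → unitInterval) (k : ℕ → OpenPartialHomeomorph M (FolModel n))
    (g : ℕ → ℝ → ℝ),
    t 0 = 0 ∧ t (m + 1) = 1 ∧ StrictMonoOn t (Iic (m + 1)) ∧
    k 0 = e ∧ k m = e' ∧
    (∀ i ≤ m, F.IsFoliatedChart (k i)) ∧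
    (∀ i ≤ m, ∀ s ∈ Icc (t i) (t (i + 1)), c s ∈ (k i).source) ∧
    (∀ i < m, ∀ᶠ z in 𝓝 (c (t (i + 1))), (k (i + 1) z).1 = g i (k i z).1) ∧
    γ = (chainComp g m : Germ (𝓝 (e p).1) ℝ)

/-- The (underlying set of the) holonomy group at `p` of the leaf through `p`, described in the
chart `e` around `p`: the germs at the transverse coordinate of `p` of the holonomy
transformations of the loops at `p` in the leaf. -/
def holonomyGroup (e : OpenPartialHomeomorph M (FolModel n)) (p : M) :
    Set (Germ (𝓝 (e p).1) ℝ) :=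
  {γ | ∃ c : @Path M F.leafTopology p p, F.IsHolonomy c e e γ}

/-- A map is foliated if it maps leaves to leaves. -/
def IsFoliatedMap (f : M → M) : Prop :=
  ∀ L, F.IsLeaf L → ∃ L', F.IsLeaf L' ∧ MapsTo f L L'

/-- A smooth flow each of whose time maps is foliated. -/
structure IsFoliatedFlow (φ : Flow ℝ M) : Prop where
  smooth : ContMDiff (𝓘(ℝ, ℝ).prod (𝓡 (n + 1))) (𝓡 (n + 1)) ∞ fun w : ℝ × M => φ w.1 w.2
  foliated : ∀ t : ℝ, F.IsFoliatedMap (φ t)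

/-- `L` is a leaf preserved by the flow. -/
def IsPreservedLeaf (φ : Flow ℝ M) (L : Set M) : Prop :=
  F.IsLeaf L ∧ ∀ t : ℝ, φ t '' L = L

/-- The local flow `ψ` induced by `φ` around the projection `x(p)` of `p` to a local transversal
(`x ∘ φᵗ = ψᵗ ∘ x`) has `x(p)` as a fixed point, and its tangent map there is
`ψᵗ_* = exp (κ t)`. -/
def HasTransverseExponent (φ : Flow ℝ M) (p : M) (κ : ℝ) : Prop :=
  ∃ e : OpenPartialHomeomorph M (FolModel n), F.IsFoliatedChart e ∧ p ∈ e.source ∧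
    ∃ ψ : ℝ → ℝ → ℝ,
      (∀ᶠ w : ℝ × M in 𝓝 (0, p), (e (φ w.1 w.2)).1 = ψ w.1 (e w.2).1) ∧
      ∀ᶠ t in 𝓝 (0 : ℝ), ψ t (e p).1 = (e p).1 ∧
        HasDerivAt (ψ t) (Real.exp (κ * t)) (e p).1

/-- All preserved leaves correspond to simple fixed points of the induced local flow on local
transversals. -/
def IsTransverselySimple (φ : Flow ℝ M) : Prop :=
  ∀ L, F.IsPreservedLeaf φ L → ∀ p ∈ L, ∃ κ : ℝ, κ ≠ 0 ∧ F.HasTransverseExponent φ p κ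

/-- `e = (x, y)` is a foliated chart around `p` with `x(p) = 0`, in which the transverse vector
field induced by the infinitesimal generator `Z` of `φ` is `κ x ∂ₓ`; that is, `dx(Z) = κ x`. -/
structure IsLinearizingChart (φ : Flow ℝ M) (p : M) (κ : ℝ)
    (e : OpenPartialHomeomorph M (FolModel n)) : Prop where
  foliated : F.IsFoliatedChart e
  mem_source : p ∈ e.source
  map_zero : (e p).1 = 0
  field : ∀ z ∈ e.source, HasDerivAt (fun t : ℝ => (e (φ t z)).1) (κ * (e z).1) 0

end Foliation

end

-- The transverse coordinate `x` turns the flow near a preserved leaf into a local flow on the line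
-- fixing the projection of the leaf. A change of foliated chart conjugates this local flow, so its
-- multiplier at the fixed point does not depend on the chart. Points of one plaque share the same
-- projection, hence the same local flow and the same multiplier. The exponent is thus locally
-- constant along leafwise paths, and it is constant on `L` because a leaf is path connected in the
-- leaf topology (`IsTransverselySimple.exists_exponent`).
--
-- Let `X` be the transverse vector field. It vanishes at `x(p)`, and its derivative there is `κ`,
-- by equality of mixed partial derivatives (`hasDerivAt_generator`). A vector field on the line
-- with a simple zero is smoothly linearizable: Hadamard's lemma reduces `u' X = κ u` to one
-- integration (`exists_linearizing_coordinate`). Using `u` as new transverse coordinate gives the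
-- linearizing chart.
--
-- For the holonomy, the coordinate `x` of a linearizing chart is regarded as a first integral of
-- the plaques satisfying `Z x = κ x`. It is continued along a loop as a function constant on
-- plaques (`IsHolonomy.exists_transport`). The eigenvalue equation survives, since it can be read
-- on the line and so is constant along plaques. On return the continuation is `H(x)`, where `H` is
-- a left inverse of the holonomy germ. Both `x` and `H(x)` satisfy the equation, so `x H' = H`;
-- smoothness at `0` then makes `H` linear, and the holonomy is multiplication by `1 / H'(0)`. The
-- sign of the derivative, measured in a coherently oriented atlas, is continued in the same way and
-- gives `H'(0) > 0`.

noncomputable section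

-- Calculus on the line: Hadamard's lemma, linearization at a simple zero, Euler's equation.

section OneVariable

/-- A germ of smooth function of one real variable is the germ of a globally smooth function. -/
theorem exists_contDiff_eventuallyEq {f : ℝ → ℝ} {x₀ : ℝ}
    (hf : ∀ᶠ x in 𝓝 x₀, ContDiffAt ℝ ∞ f x) :
    ∃ g : ℝ → ℝ, ContDiff ℝ ∞ g ∧ g =ᶠ[𝓝 x₀] f := by
  obtain ⟨r, hr, hrf⟩ := Metric.eventually_nhds_iff_ball.1 hf
  let b : ContDiffBump x₀ := ⟨r / 4, r / 2, by positivity, by linarith⟩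
  refine ⟨fun x => b x * f x, ?_, ?_⟩
  · rw [contDiff_iff_contDiffAt]
    intro x
    by_cases hx : x ∈ Metric.ball x₀ r
    · exact b.contDiff.contDiffAt.mul (hrf x hx)
    · have hx' : x ∉ tsupport b := by
        rw [b.tsupport_eq]
        intro h
        apply hx
        have : dist x x₀ ≤ r / 2 := h
        exact lt_of_le_of_lt this (by linarith)
      have h0 : (fun x => b x * f x) =ᶠ[𝓝 x] fun _ => 0 := by
        filter_upwards [notMem_tsupport_iff_eventuallyEq.1 hx'] with y hy
        simp [hy]
      exact contDiffAt_const.congr_of_eventuallyEq h0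
  · filter_upwards [b.eventuallyEq_one] with y hy
    simp [hy]

/-- Differentiation under the integral sign for weighted averages of dilations. -/
theorem hasDerivAt_integral_pow_mul_comp_mul {f : ℝ → ℝ} (hf : ContDiff ℝ 1 f) (k : ℕ) (x : ℝ) :
    HasDerivAt (fun x => ∫ u in (0 : ℝ)..1, u ^ k * f (x * u))
      (∫ u in (0 : ℝ)..1, u ^ (k + 1) * deriv f (x * u)) x := by
  have hf' : Continuous (deriv f) := hf.continuous_deriv le_rfl
  have hfd : Differentiable ℝ f := hf.differentiable one_ne_zero
  have hfc : Continuous f := hf.continuous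
  obtain ⟨C, hC⟩ := ((isCompact_closedBall x 1).prod
    (isCompact_Icc (a := (0 : ℝ)) (b := 1))).exists_bound_of_continuousOn
    (f := fun w : ℝ × ℝ => w.2 ^ (k + 1) * deriv f (w.1 * w.2)) (by fun_prop)
  refine (intervalIntegral.hasDerivAt_integral_of_dominated_loc_of_deriv_le
    (F := fun x u => u ^ k * f (x * u)) (F' := fun x u => u ^ (k + 1) * deriv f (x * u))
    (bound := fun _ => C) (Metric.closedBall_mem_nhds x one_pos) ?_ ?_ ?_ ?_ ?_ ?_).2
  · exact Eventually.of_forall fun y => (by fun_prop : Continuous _).aestronglyMeasurable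
  · exact (by fun_prop : Continuous _).intervalIntegrable _ _
  · exact (by fun_prop : Continuous _).aestronglyMeasurable
  · refine Eventually.of_forall fun u hu y hy => ?_
    rw [uIoc_of_le zero_le_one] at hu
    exact hC (y, u) ⟨hy, hu.1.le, hu.2⟩
  · exact intervalIntegrable_const
  · refine Eventually.of_forall fun u _ y _ => ?_
    have h1 : HasDerivAt (fun y : ℝ => y * u) u y := by
      simpa using (hasDerivAt_id y).mul_const u
    have h2 := ((hfd (y * u)).hasDerivAt.comp y h1).const_mul (u ^ k)
    refine h2.congr_deriv ?_
    ring

/-- Differentiating replaces `f` by `deriv f` and `k` by `k + 1`, so the family is closed under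
differentiation. The weight `u ^ k` is there only to let this induction close. -/
theorem contDiff_integral_pow_mul_comp_mul {f : ℝ → ℝ} (hf : ContDiff ℝ ∞ f) (k : ℕ) :
    ContDiff ℝ ∞ (fun x => ∫ u in (0 : ℝ)..1, u ^ k * f (x * u)) := by
  rw [contDiff_infty]
  intro N
  induction N generalizing f k with
  | zero =>
    have h : ∀ x, DifferentiableAt ℝ (fun x => ∫ u in (0 : ℝ)..1, u ^ k * f (x * u)) x := fun x =>
      (hasDerivAt_integral_pow_mul_comp_mul
        (hf.of_le (by exact_mod_cast le_top)) k x).differentiableAt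
    exact contDiff_zero.2 (Differentiable.continuous h)
  | succ N ih =>
    have h := hasDerivAt_integral_pow_mul_comp_mul (f := f) (hf.of_le (by exact_mod_cast le_top)) k
    push_cast
    rw [contDiff_succ_iff_deriv]
    refine ⟨fun x => (h x).differentiableAt, by simp, ?_⟩
    rw [show deriv (fun x => ∫ u in (0 : ℝ)..1, u ^ k * f (x * u)) = _ from
      funext fun x => (h x).deriv]
    exact ih (contDiff_infty_iff_deriv.1 hf).2 (k + 1)

/-- Hadamard's lemma in one variable. -/
theorem exists_contDiff_eq_add_mul {f : ℝ → ℝ} (hf : ContDiff ℝ ∞ f) (x₀ : ℝ) :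
    ∃ g : ℝ → ℝ, ContDiff ℝ ∞ g ∧ g x₀ = deriv f x₀ ∧ ∀ x, f x = f x₀ + (x - x₀) * g x := by
  have hd : ContDiff ℝ ∞ (deriv f) := (contDiff_infty_iff_deriv.1 hf).2
  have hs : ContDiff ℝ ∞ fun s => deriv f (x₀ + s) := hd.comp (contDiff_const.add contDiff_id)
  -- The quotient is the mean of `deriv f` over the segment from `x₀` to `x`, namely `∫ u in 0..1,
  -- deriv f (x₀ + (x - x₀) * u)`.
  have hg := (contDiff_integral_pow_mul_comp_mul hs 0).comp
    (contDiff_id.sub (contDiff_const (c := x₀)))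
  refine ⟨_, hg, by simp, fun x => ?_⟩
  have hfd : Differentiable ℝ f := hf.differentiable (by simp)
  have key : ∀ u ∈ uIcc (0 : ℝ) 1, HasDerivAt (fun u => f (x₀ + (x - x₀) * u))
      ((x - x₀) * deriv f (x₀ + (x - x₀) * u)) u := fun u _ => by
    have h1 : HasDerivAt (fun u : ℝ => x₀ + (x - x₀) * u) (x - x₀) u := by
      simpa using ((hasDerivAt_id u).const_mul (x - x₀)).const_add x₀
    refine ((hfd _).hasDerivAt.comp u h1).congr_deriv (mul_comm _ _)
  have hc : Continuous (deriv f) := hd.continuous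
  have := intervalIntegral.integral_eq_sub_of_hasDerivAt key
    ((by fun_prop : Continuous _).intervalIntegrable _ _)
  simp only [intervalIntegral.integral_const_mul, mul_one, mul_zero, add_zero] at this
  simp only [Function.comp_apply, id, pow_zero, one_mul, this]
  ring_nf

/-- Smooth linearization of a vector field on the line around a simple zero. -/
theorem exists_linearizing_coordinate {X : ℝ → ℝ} {x₀ κ : ℝ}
    (hX : ∀ᶠ x in 𝓝 x₀, ContDiffAt ℝ ∞ X x) (h0 : X x₀ = 0) (hd : HasDerivAt X κ x₀)
    (hκ : κ ≠ 0) :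
    ∃ u : ℝ → ℝ, ContDiff ℝ ∞ u ∧ u x₀ = 0 ∧ deriv u x₀ ≠ 0 ∧
      ∀ᶠ x in 𝓝 x₀, deriv u x * X x = κ * u x := by
  obtain ⟨Y, hY, hYX⟩ := exists_contDiff_eventuallyEq hX
  obtain ⟨A, hA, hA0, hYA⟩ := exists_contDiff_eq_add_mul hY x₀
  obtain ⟨B, hB, -, hAB⟩ := exists_contDiff_eq_add_mul hA x₀
  have hY0 : Y x₀ = 0 := by rw [hYX.eq_of_nhds, h0]
  have hAκ : A x₀ = κ := by rw [hA0, hYX.deriv_eq, hd.deriv]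
  have hAne : ∀ᶠ x in 𝓝 x₀, A x ≠ 0 :=
    hA.continuous.continuousAt.eventually_ne (by rwa [hAκ])
  -- Near `x₀`, `X = (x - x₀) A` with `A = κ + (x - x₀) B`. For `u = (x - x₀) exp W` and `W' = w`,
  -- the equation `u' X = κ u` follows from `A (1 + (x - x₀) w) = κ`, which `w = -B / A` solves
  -- without a singularity at `x₀`.
  obtain ⟨w, hw, hwAB⟩ := exists_contDiff_eventuallyEq (f := fun x => -B x / A x) (x₀ := x₀) <| by
    filter_upwards [hAne] with x hx
    exact hB.contDiffAt.neg.div hA.contDiffAt hx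
  have hWd : ∀ x, HasDerivAt (fun x => ∫ s in x₀..x, w s) (w x) x := fun x =>
    intervalIntegral.integral_hasDerivAt_right (hw.continuous.intervalIntegrable _ _)
      (hw.continuous.stronglyMeasurableAtFilter _ _) hw.continuous.continuousAt
  have hW : ContDiff ℝ ∞ fun x => ∫ s in x₀..x, w s := by
    rw [contDiff_infty_iff_deriv]
    refine ⟨fun x => (hWd x).differentiableAt, ?_⟩
    rwa [show deriv (fun x => ∫ s in x₀..x, w s) = w from funext fun x => (hWd x).deriv]
  have hu : ∀ x, HasDerivAt (fun x => (x - x₀) * Real.exp (∫ s in x₀..x, w s))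
      (Real.exp (∫ s in x₀..x, w s) * (1 + (x - x₀) * w x)) x := fun x => by
    refine (((hasDerivAt_id x).sub_const x₀).mul (hWd x).exp).congr_deriv ?_
    simp only [id]; ring
  refine ⟨fun x => (x - x₀) * Real.exp (∫ s in x₀..x, w s),
    (contDiff_id.sub contDiff_const).mul hW.exp, by simp, by simp [(hu x₀).deriv], ?_⟩
  filter_upwards [hYX, hAne, hwAB] with x hx hne hwx
  rw [(hu x).deriv, ← hx, hYA x, hY0, hwx]
  have h2 := hAB x
  rw [hAκ] at h2
  field_simp
  linear_combination A x * (x - x₀) * h2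

/-- A function with `x H'(x) = H(x)` near `0` is linear near `0`. -/
theorem eventually_eq_mul_of_mul_deriv_eq {H : ℝ → ℝ} (hH : ContDiffAt ℝ ∞ H 0)
    (h : ∀ᶠ x in 𝓝 (0 : ℝ), deriv H x * x = H x) :
    ∀ᶠ x in 𝓝 (0 : ℝ), H x = deriv H 0 * x := by
  have hd : ∀ᶠ x in 𝓝 (0 : ℝ), DifferentiableAt ℝ H x := by
    filter_upwards [(hH.of_le (m := 1) (by exact_mod_cast le_top)).eventually (by simp)] with x hx
    exact hx.differentiableAt one_ne_zero
  obtain ⟨r, hr, hb⟩ := Metric.eventually_nhds_iff_ball.1 (h.and hd)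
  have hH0 : H 0 = 0 := by simpa using h.self_of_nhds.symm
  -- Euler's argument: the equation makes `H y / y` constant along each ray from the origin.
  have hconst : ∀ x ∈ Metric.ball (0 : ℝ) r, x ≠ 0 → ∀ s ∈ Ioc (0 : ℝ) 1,
      H (s * x) / (s * x) = H x / x := by
    intro x hx hx0 s hs
    have hmem : ∀ σ ∈ Icc s 1, σ * x ∈ Metric.ball (0 : ℝ) r ∧ σ * x ≠ 0 := by
      intro σ hσ
      have hσ0 : 0 < σ := hs.1.trans_le hσ.1
      refine ⟨?_, mul_ne_zero hσ0.ne' hx0⟩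
      rw [mem_ball_zero_iff] at hx ⊢
      rw [norm_mul, Real.norm_of_nonneg hσ0.le]
      nlinarith [hσ.2, norm_nonneg x]
    have hder : ∀ σ ∈ Icc s 1, HasDerivAt (fun σ => H (σ * x) / (σ * x)) 0 σ := by
      intro σ hσ
      obtain ⟨h1, h2⟩ := hmem σ hσ
      have h3 : HasDerivAt (fun σ : ℝ => σ * x) x σ := by
        simpa using (hasDerivAt_id σ).mul_const x
      have h4 := (((hb _ h1).2.hasDerivAt.comp σ h3).div h3 h2)
      refine h4.congr_deriv ?_
      have h5 := (hb _ h1).1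
      simp only [Function.comp_apply, ← h5]
      rw [div_eq_zero_iff]
      left; ring
    have := constant_of_derivWithin_zero (f := fun σ => H (σ * x) / (σ * x)) (a := s) (b := 1)
      (fun σ hσ => (hder σ hσ).differentiableAt.differentiableWithinAt)
      (fun σ hσ => ((hder σ ⟨hσ.1, hσ.2.le⟩).hasDerivWithinAt).derivWithin
        ((uniqueDiffOn_Icc (lt_of_le_of_lt hσ.1 hσ.2)) _ ⟨hσ.1, hσ.2.le⟩)) 1 ⟨hs.2, le_rfl⟩
    simpa using this.symm
  filter_upwards [Metric.ball_mem_nhds 0 hr] with x hx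
  by_cases hx0 : x = 0
  · simp [hx0, hH0]
  -- Differentiability at `0` identifies the constant with `deriv H 0` whatever the sign of `x`, so
  -- both half-lines have the same slope.
  have hlim : Tendsto (fun s : ℝ => H (s * x) / (s * x)) (𝓝[>] 0) (𝓝 (deriv H 0)) := by
    have h1 := hasDerivAt_iff_tendsto_slope_zero.1 (hb 0 (Metric.mem_ball_self hr)).2.hasDerivAt
    simp only [zero_add, hH0, sub_zero, smul_eq_mul] at h1
    have h2 : Tendsto (fun s : ℝ => s * x) (𝓝[>] 0) (𝓝[≠] 0) := by
      refine tendsto_nhdsWithin_iff.2 ⟨?_, ?_⟩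
      · have : Tendsto (fun s : ℝ => s * x) (𝓝 0) (𝓝 (0 * x)) := tendsto_id.mul_const x
        rw [zero_mul] at this
        exact this.mono_left nhdsWithin_le_nhds
      · filter_upwards [self_mem_nhdsWithin] with s hs
        exact mul_ne_zero (ne_of_gt hs) hx0
    refine (h1.comp h2).congr fun s => ?_
    simp only [Function.comp_apply]; ring
  have hev : (fun s : ℝ => H (s * x) / (s * x)) =ᶠ[𝓝[>] 0] fun _ => H x / x := by
    filter_upwards [Ioc_mem_nhdsGT (zero_lt_one' ℝ)] with s hs
    exact hconst x hx hx0 s hs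
  have := tendsto_nhds_unique (hlim.congr' hev) tendsto_const_nhds
  rw [this]; field_simp

end OneVariable


-- Transverse coordinates, transverse slices and changes of coordinate on the line.

section Charts

variable {n : ℕ} {M : Type*} [TopologicalSpace M]

/-- A chart is a local homeomorphism and the first projection is open. The equality of filters lets
germs of functions of the transverse coordinate pass between `M` and `ℝ` in both directions. -/
theorem map_transverse_nhds {e : OpenPartialHomeomorph M (FolModel n)} {q : M}
    (hq : q ∈ e.source) : map (fun z => (e z).1) (𝓝 q) = 𝓝 (e q).1 := by
  rw [← map_fst_nhds, ← e.map_nhds_eq hq, map_map]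
  rfl

theorem eventually_transverse_iff {e : OpenPartialHomeomorph M (FolModel n)} {q : M}
    (hq : q ∈ e.source) {P : ℝ → Prop} :
    (∀ᶠ z in 𝓝 q, P (e z).1) ↔ ∀ᶠ x in 𝓝 (e q).1, P x := by
  rw [← map_transverse_nhds hq, eventually_map]

theorem tendsto_transverse {e : OpenPartialHomeomorph M (FolModel n)} {q : M}
    (hq : q ∈ e.source) : Tendsto (fun z => (e z).1) (𝓝 q) (𝓝 (e q).1) :=
  (map_transverse_nhds hq).le

theorem transverse_factor_unique {e : OpenPartialHomeomorph M (FolModel n)} {q : M}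
    (hq : q ∈ e.source) {f : M → ℝ} {g h : ℝ → ℝ} (hg : ∀ᶠ z in 𝓝 q, f z = g (e z).1)
    (hh : ∀ᶠ z in 𝓝 q, f z = h (e z).1) : g =ᶠ[𝓝 (e q).1] h :=
  (eventually_transverse_iff hq (P := fun x => g x = h x)).1 <| by
    filter_upwards [hg, hh] with z h1 h2
    rw [← h1, h2]

/-- The slice of the chart through `q` transverse to the foliation. -/
def transverseSlice (e : OpenPartialHomeomorph M (FolModel n)) (q : M) (x : ℝ) : M :=
  e.symm (x, (e q).2)

theorem transverseSlice_self {e : OpenPartialHomeomorph M (FolModel n)} {q : M}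
    (hq : q ∈ e.source) : transverseSlice e q (e q).1 = q :=
  e.left_inv hq

theorem eventually_slice_mem_target {e : OpenPartialHomeomorph M (FolModel n)} {q : M}
    (hq : q ∈ e.source) : ∀ᶠ x in 𝓝 (e q).1, ((x, (e q).2) : FolModel n) ∈ e.target := by
  have hc : ContinuousAt (fun x : ℝ => ((x, (e q).2) : FolModel n)) (e q).1 := by fun_prop
  exact hc.eventually (e.open_target.mem_nhds (e.map_source hq))

theorem tendsto_transverseSlice {e : OpenPartialHomeomorph M (FolModel n)} {q : M}
    (hq : q ∈ e.source) : Tendsto (transverseSlice e q) (𝓝 (e q).1) (𝓝 q) := by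
  have hc : ContinuousAt (fun x : ℝ => ((x, (e q).2) : FolModel n)) (e q).1 := by fun_prop
  have h2 : ContinuousAt e.symm (e q) := e.symm.continuousAt (e.map_source hq)
  have h3 : Tendsto (transverseSlice e q) (𝓝 (e q).1) (𝓝 (e.symm (e q))) := h2.tendsto.comp hc
  rwa [e.left_inv hq] at h3

theorem eventually_transverse_slice {e : OpenPartialHomeomorph M (FolModel n)} {q : M}
    (hq : q ∈ e.source) : ∀ᶠ x in 𝓝 (e q).1, (e (transverseSlice e q x)).1 = x := by
  filter_upwards [eventually_slice_mem_target hq] with x hx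
  rw [transverseSlice, e.right_inv hx]

/-- A local diffeomorphism of the line around a point with nonzero derivative. -/
theorem exists_smooth_openPartialHomeomorph {u : ℝ → ℝ} {x₀ : ℝ} (hu : ContDiff ℝ ∞ u)
    (h0 : deriv u x₀ ≠ 0) :
    ∃ v : OpenPartialHomeomorph ℝ ℝ, x₀ ∈ v.source ∧ (∀ x, v x = u x) ∧
      ContDiffOn ℝ ∞ v v.source ∧ ContDiffOn ℝ ∞ v.symm v.target := by
  have hd : Differentiable ℝ u := hu.differentiable (by simp)
  have hc : Continuous (deriv u) := (contDiff_infty_iff_deriv.1 hu).2.continuous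
  have hf : HasFDerivAt u
      ((ContinuousLinearEquiv.unitsEquivAut ℝ (Units.mk0 _ h0) : ℝ ≃L[ℝ] ℝ) : ℝ →L[ℝ] ℝ) x₀ := by
    refine (hd x₀).hasDerivAt.hasFDerivAt.congr_fderiv ?_
    ext; simp
  let v₀ := hu.contDiffAt.toOpenPartialHomeomorph u hf (by simp)
  -- The source is cut down to where `u'` does not vanish, so that the inverse is smooth on the
  -- whole target and not only near the image of `x₀`.
  have ho : IsOpen {x | deriv u x ≠ 0} := isOpen_ne_fun hc continuous_const
  refine ⟨v₀.restrOpen _ ho, ⟨hu.contDiffAt.mem_toOpenPartialHomeomorph_source hf (by simp), h0⟩,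
    fun x => rfl, hu.contDiffOn, fun y hy => ?_⟩
  refine ((v₀.restrOpen _ ho).contDiffAt_symm_deriv (f₀' := deriv u ((v₀.restrOpen _ ho).symm y))
    ?_ hy (hd _).hasDerivAt hu.contDiffAt).contDiffWithinAt
  exact ((v₀.restrOpen _ ho).map_target hy).2

end Charts

-- Foliated charts: smooth transitions, reparametrization and shrinking.

namespace Foliation

variable {n : ℕ} {M : Type*} [TopologicalSpace M]
  [ChartedSpace (EuclideanSpace ℝ (Fin (n + 1))) M] {F : Foliation n M}

theorem isFoliatedChart_of_mem_atlas {a : OpenPartialHomeomorph M (FolModel n)}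
    (ha : a ∈ F.atlas) : F.IsFoliatedChart a :=
  ⟨F.chart_smooth a ha, fun b hb => F.compat b hb a ha, fun b hb => F.compat a ha b hb⟩

namespace IsFoliatedChart

/-- By definition a foliated chart is compared only with charts of `F.atlas`; two such charts are
compared by passing through an atlas chart at the point. -/
theorem compat {e e' : OpenPartialHomeomorph M (FolModel n)} (he : F.IsFoliatedChart e)
    (he' : F.IsFoliatedChart e') : TransverselyCompatible e e' := by
  rintro q ⟨hq, hq'⟩
  obtain ⟨a, ha, hqa⟩ := F.cover q
  obtain ⟨h₁, hh₁⟩ := he.compat_right a ha q ⟨hq, hqa⟩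
  obtain ⟨h₂, hh₂⟩ := he'.compat_left a ha q ⟨hqa, hq'⟩
  refine ⟨h₂ ∘ h₁, ?_⟩
  filter_upwards [hh₁, hh₂] with z h1 h2
  rw [h2, h1, Function.comp_apply]

theorem contMDiffAt_transverseSlice {e : OpenPartialHomeomorph M (FolModel n)}
    (he : F.IsFoliatedChart e) {q : M} {x : ℝ}
    (hx : ((x, (e q).2) : FolModel n) ∈ e.target) :
    ContMDiffAt 𝓘(ℝ, ℝ) (𝓡 (n + 1)) ∞ (transverseSlice e q) x := by
  have h1 : ContMDiffAt 𝓘(ℝ, FolModel n) (𝓡 (n + 1)) ∞ e.symm ((x, (e q).2) : FolModel n) :=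
    (he.box_chart.smooth_symm _ hx).contMDiffAt (e.open_target.mem_nhds hx)
  have h2 : ContMDiffAt 𝓘(ℝ, ℝ) 𝓘(ℝ, FolModel n) ∞
      (fun x : ℝ => ((x, (e q).2) : FolModel n)) x :=
    (contDiffAt_id.prodMk contDiffAt_const).contMDiffAt
  exact h1.comp x h2

theorem contMDiffAt_transverse {e : OpenPartialHomeomorph M (FolModel n)}
    (he : F.IsFoliatedChart e) {q : M} (hq : q ∈ e.source) :
    ContMDiffAt (𝓡 (n + 1)) 𝓘(ℝ, ℝ) ∞ (fun z => (e z).1) q := by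
  have h1 : ContMDiffAt (𝓡 (n + 1)) 𝓘(ℝ, FolModel n) ∞ e q :=
    (he.box_chart.smooth _ hq).contMDiffAt (e.open_source.mem_nhds hq)
  have h2 : ContMDiffAt 𝓘(ℝ, FolModel n) 𝓘(ℝ, ℝ) ∞ (fun w : FolModel n => w.1) (e q) :=
    contDiffAt_fst.contMDiffAt
  exact h2.comp q h1

/-- Every local transformation relating the transverse coordinates of two foliated charts is
smooth. -/
theorem contDiffAt_transition {e e' : OpenPartialHomeomorph M (FolModel n)}
    (he : F.IsFoliatedChart e) (he' : F.IsFoliatedChart e') {q : M} (hq : q ∈ e.source)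
    (hq' : q ∈ e'.source) {h : ℝ → ℝ} (hh : ∀ᶠ z in 𝓝 q, (e' z).1 = h (e z).1) :
    ContDiffAt ℝ ∞ h (e q).1 := by
  -- No regularity of `h` is assumed; it is recovered by restricting `e'` to a transverse slice of
  -- `e`, where `h` becomes a composite of smooth maps.
  have h1 : ContMDiffAt 𝓘(ℝ, ℝ) 𝓘(ℝ, ℝ) ∞ (fun x => (e' (transverseSlice e q x)).1) (e q).1 := by
    have h2 := he'.contMDiffAt_transverse hq'
    rw [← transverseSlice_self hq] at h2
    exact h2.comp _ (he.contMDiffAt_transverseSlice (e.map_source hq))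
  refine h1.contDiffAt.congr_of_eventuallyEq ?_
  filter_upwards [(tendsto_transverseSlice hq).eventually hh, eventually_transverse_slice hq]
    with x hx hx'
  rw [hx, hx']

/-- The local transformations relating the transverse coordinates of two foliated charts are
mutually inverse germs of diffeomorphisms. -/
theorem exists_transition_inverse {e e' : OpenPartialHomeomorph M (FolModel n)}
    (he : F.IsFoliatedChart e) (he' : F.IsFoliatedChart e') {q : M} (hq : q ∈ e.source)
    (hq' : q ∈ e'.source) {h : ℝ → ℝ} (hh : ∀ᶠ z in 𝓝 q, (e' z).1 = h (e z).1) :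
    ∃ k : ℝ → ℝ, (∀ᶠ z in 𝓝 q, (e z).1 = k (e' z).1) ∧ ContDiffAt ℝ ∞ k (e' q).1 ∧
      (∀ᶠ x in 𝓝 (e q).1, k (h x) = x) ∧ deriv k (e' q).1 * deriv h (e q).1 = 1 := by
  obtain ⟨k, hk⟩ := he'.compat he q ⟨hq', hq⟩
  have hkh : ∀ᶠ x in 𝓝 (e q).1, k (h x) = x := (eventually_transverse_iff hq).1 <| by
    filter_upwards [hh, hk] with z h1 h2
    rw [← h1, ← h2]
  have hkd := he'.contDiffAt_transition he hq' hq hk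
  refine ⟨k, hk, hkd, hkh, ?_⟩
  have hhd := (he.contDiffAt_transition he' hq hq' hh).differentiableAt (by simp)
  have hkd' := hkd.differentiableAt (by simp)
  rw [hh.self_of_nhds] at hkd' ⊢
  have h3 := (hkd'.hasDerivAt.comp _ hhd.hasDerivAt).congr_of_eventuallyEq
    (f₁ := id) (by filter_upwards [hkh] with x hx using hx.symm)
  exact h3.unique (hasDerivAt_id _)

/-- Reparametrizing the transverse coordinate of a foliated chart and shrinking its domain. -/
theorem exists_reparam {e : OpenPartialHomeomorph M (FolModel n)} (he : F.IsFoliatedChart e)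
    {p : M} (hp : p ∈ e.source) {v : OpenPartialHomeomorph ℝ ℝ} (hpv : (e p).1 ∈ v.source)
    (hv : ContDiffOn ℝ ∞ v v.source) (hv' : ContDiffOn ℝ ∞ v.symm v.target)
    {V : Set M} (hV : V ∈ 𝓝 p) :
    ∃ e' : OpenPartialHomeomorph M (FolModel n), F.IsFoliatedChart e' ∧ p ∈ e'.source ∧
      e'.source ⊆ V ∩ e.source ∧ ∀ z ∈ e'.source, (e' z).1 = v (e z).1 := by
  let w : OpenPartialHomeomorph (FolModel n) (FolModel n) :=
    v.prod (OpenPartialHomeomorph.refl (EuclideanSpace ℝ (Fin n)))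
  have hw : ContDiffOn ℝ ∞ w w.source := by
    have h1 : ContDiffOn ℝ ∞ (fun z : FolModel n => v z.1) w.source :=
      hv.comp contDiffOn_fst fun z hz => by
        have : z ∈ v.source ×ˢ (univ : Set (EuclideanSpace ℝ (Fin n))) := hz
        exact this.1
    exact h1.prodMk contDiffOn_snd
  have hw' : ContDiffOn ℝ ∞ w.symm w.target := by
    have h1 : ContDiffOn ℝ ∞ (fun z : FolModel n => v.symm z.1) w.target :=
      hv'.comp contDiffOn_fst fun z hz => by
        have : z ∈ v.target ×ˢ (univ : Set (EuclideanSpace ℝ (Fin n))) := hz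
        exact this.1
    exact h1.prodMk contDiffOn_snd
  let T := e.trans w
  have hpT : p ∈ T.source := by
    rw [OpenPartialHomeomorph.trans_source]
    exact ⟨hp, hpv, mem_univ _⟩
  have hN : T.target ∩ T.symm ⁻¹' interior V ∈ 𝓝 (T p) := by
    refine (T.isOpen_inter_preimage_symm isOpen_interior).mem_nhds ⟨T.map_source hpT, ?_⟩
    rw [mem_preimage, T.left_inv hpT]
    exact mem_interior_iff_mem_nhds.2 hV
  -- A ball for the sup metric of the product is a product of balls, which is the box shape required
  -- of a chart image.
  obtain ⟨r, hr, hrN⟩ := Metric.mem_nhds_iff.1 hN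
  rw [← Prod.mk.eta (p := T p), ← ball_prod_same] at hrN
  have ho : IsOpen (Metric.ball (T p).1 r ×ˢ Metric.ball (T p).2 r) :=
    Metric.isOpen_ball.prod Metric.isOpen_ball
  let e' := (T.symm.restrOpen _ ho).symm
  have htar : e'.target = Metric.ball (T p).1 r ×ˢ Metric.ball (T p).2 r :=
    inter_eq_right.2 fun z hz => (hrN hz).1
  have hsrc : ∀ z ∈ e'.source, z ∈ T.source ∧ z ∈ V := by
    intro z hz
    have h1 : z ∈ T.source := hz.1
    refine ⟨h1, ?_⟩
    have h2 := (hrN (htar ▸ e'.map_source hz : e' z ∈ _)).2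
    rw [mem_preimage, show e' z = T z from rfl, T.left_inv h1] at h2
    exact interior_subset h2
  have hTe : ∀ z ∈ T.source, z ∈ e.source ∧ e z ∈ w.source := fun z hz => by
    rwa [OpenPartialHomeomorph.trans_source] at hz
  have hfst : ∀ z, (e' z).1 = v (e z).1 := fun z => rfl
  have hvinv : ∀ z ∈ e'.source, (e z).1 = v.symm (e' z).1 := fun z hz => by
    rw [hfst, v.left_inv (hTe z (hsrc z hz).1).2.1]
  have hpe' : p ∈ e'.source := by
    refine ⟨hpT, ?_⟩
    exact ⟨Metric.mem_ball_self hr, Metric.mem_ball_self hr⟩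
  refine ⟨e', ⟨⟨?_, ?_, _, _, _, _, htar⟩, ?_, ?_⟩, hpe',
    fun z hz => ⟨(hsrc z hz).2, (hTe z (hsrc z hz).1).1⟩, fun z _ => hfst z⟩
  · exact hw.contMDiffOn.comp (he.box_chart.smooth.mono fun z hz => (hTe z (hsrc z hz).1).1)
      fun z hz => (hTe z (hsrc z hz).1).2
  · refine he.box_chart.smooth_symm.comp (hw'.contMDiffOn.mono fun z hz => ?_) fun z hz => ?_
    · have := (hrN (htar ▸ hz)).1
      rw [OpenPartialHomeomorph.trans_target] at this
      exact this.1
    · have := (hrN (htar ▸ hz)).1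
      rw [OpenPartialHomeomorph.trans_target] at this
      exact this.2
  · rintro a ha q ⟨hqa, hq⟩
    obtain ⟨h, hh⟩ := he.compat_left a ha q ⟨hqa, (hTe q (hsrc q hq).1).1⟩
    refine ⟨v ∘ h, ?_⟩
    filter_upwards [hh] with z hz
    rw [hfst, hz, Function.comp_apply]
  · rintro a ha q ⟨hq, hqa⟩
    obtain ⟨h, hh⟩ := he.compat_right a ha q ⟨(hTe q (hsrc q hq).1).1, hqa⟩
    refine ⟨h ∘ v.symm, ?_⟩
    filter_upwards [hh, e'.open_source.mem_nhds hq] with z hz hz'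
    rw [hz, Function.comp_apply, ← hvinv z hz']

end IsFoliatedChart

-- The leaf topology and paths in leaves.

/-- Foliated charts can be shrunk into any open set (reparametrization by the identity), so every
open set is a union of plaques. -/
theorem leafTopology_le : F.leafTopology ≤ (inferInstance : TopologicalSpace M) := by
  intro V hV
  rw [@isOpen_iff_forall_mem_open]
  intro q hq
  obtain ⟨a, ha, hqa⟩ := F.cover q
  obtain ⟨e, he, hqe, heV, -⟩ := (isFoliatedChart_of_mem_atlas ha).exists_reparam hqa
    (v := OpenPartialHomeomorph.refl ℝ) (mem_univ _) contDiffOn_id contDiffOn_id (hV.mem_nhds hq)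
  exact ⟨plaque e (e q).1, fun z hz => (heV hz.1).1,
    TopologicalSpace.isOpen_generateFrom_of_mem ⟨e, _, he, rfl⟩, hqe, rfl⟩

/-- Along a path in a leaf, the points near `c s` lie in the plaque of `c s`. -/
theorem eventually_path_mem {p q : M} (c : @Path M F.leafTopology p q) (s : unitInterval)
    {e : OpenPartialHomeomorph M (FolModel n)} (he : F.IsFoliatedChart e)
    (hs : c s ∈ e.source) {P : M → Prop} (hP : ∀ᶠ z in 𝓝 (c s), P z) :
    ∀ᶠ s' in 𝓝 s, P (c s') ∧ (e (c s')).1 = (e (c s)).1 := by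
  have hc : @Continuous _ _ _ F.leafTopology c := @Path.continuous M F.leafTopology p q c
  have hc' : Continuous c := continuous_le_rng leafTopology_le hc
  have ho : IsOpen (c ⁻¹' plaque e (e (c s)).1) :=
    @IsOpen.preimage _ _ _ F.leafTopology _ hc _
      (TopologicalSpace.isOpen_generateFrom_of_mem ⟨e, _, he, rfl⟩)
  filter_upwards [ho.mem_nhds ⟨hs, rfl⟩, hc'.continuousAt.eventually hP] with s' h1 h2
  exact ⟨h2, h1.2⟩

theorem path_mem_leaf {L : Set M} (hL : F.IsLeaf L) {p q : M} (hp : p ∈ L)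
    (c : @Path M F.leafTopology p q) (s : unitInterval) : c s ∈ L := by
  obtain ⟨p₀, rfl⟩ := hL
  let _ := F.leafTopology
  have h : Joined p (c s) := ⟨(c.truncateOfLE (t₀ := 0) (t₁ := s) s.2.1).cast (by simp) (by simp)⟩
  exact Joined.trans (hp : Joined p₀ p) h

end Foliation

/-- A property which is locally constant on a preconnected set is constant on it. -/
theorem IsPreconnected.iff_of_locally_iff {α : Type*} [TopologicalSpace α] {S : Set α}
    (hS : IsPreconnected S) {P : α → Prop}
    (hP : ∀ s ∈ S, ∀ᶠ s' in 𝓝[S] s, P s' ↔ P s) {s s' : α} (hs : s ∈ S) (hs' : s' ∈ S) :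
    P s' ↔ P s := by
  classical
  have hc : ContinuousOn (fun s => decide (P s)) S := fun s hs => by
    refine (tendsto_const_nhds (x := decide (P s))).congr' ?_
    filter_upwards [hP s hs] with s' h
    exact (decide_eq_decide.2 h).symm
  exact decide_eq_decide.1 (hS.constant hc hs' hs)


-- The induced transverse flow and constancy of its exponent on a leaf.

namespace Foliation

variable {n : ℕ} {M : Type*} [TopologicalSpace M]

theorem tendsto_flow_nhds (φ : Flow ℝ M) (q : M) :
    Tendsto (fun w : ℝ × M => φ w.1 w.2) (𝓝 (0, q)) (𝓝 q) := by
  have h : ContinuousAt (fun w : ℝ × M => φ w.1 w.2) (0, q) := φ.cont'.continuousAt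
  have h0 : φ 0 q = q := φ.map_zero_apply q
  simpa only [ContinuousAt, h0] using h

theorem tendsto_flow_time (φ : Flow ℝ M) (q : M) :
    Tendsto (fun t : ℝ => φ t q) (𝓝 0) (𝓝 q) := by
  have h : Tendsto (fun t : ℝ => (t, q)) (𝓝 0) (𝓝 (0, q)) := by
    have : Continuous fun t : ℝ => (t, q) := by fun_prop
    exact this.tendsto 0
  exact (tendsto_flow_nhds φ q).comp h

/-- The local flow `ψ` on the line is induced by `φ` around `p`, through the transverse
coordinate of `e`. -/
def InducesTransverseFlow (φ : Flow ℝ M) (p : M) (e : OpenPartialHomeomorph M (FolModel n))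
    (ψ : ℝ → ℝ → ℝ) : Prop :=
  ∀ᶠ w : ℝ × M in 𝓝 (0, p), (e (φ w.1 w.2)).1 = ψ w.1 (e w.2).1

theorem InducesTransverseFlow.conj {φ : Flow ℝ M} {p : M}
    {e e' : OpenPartialHomeomorph M (FolModel n)} {ψ : ℝ → ℝ → ℝ}
    (hψ : InducesTransverseFlow φ p e ψ) {h k : ℝ → ℝ}
    (hh : ∀ᶠ z in 𝓝 p, (e' z).1 = h (e z).1) (hk : ∀ᶠ z in 𝓝 p, (e z).1 = k (e' z).1) :
    InducesTransverseFlow φ p e' fun t x => h (ψ t (k x)) := by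
  have hsnd : Tendsto (fun w : ℝ × M => w.2) (𝓝 (0, p)) (𝓝 p) := continuousAt_snd
  filter_upwards [hψ, (tendsto_flow_nhds φ p).eventually hh, hsnd.eventually hk] with w h1 h2 h3
  rw [h2, h1, h3]

theorem InducesTransverseFlow.eventually_eventually {φ : Flow ℝ M} {p : M}
    {e : OpenPartialHomeomorph M (FolModel n)} {ψ : ℝ → ℝ → ℝ}
    (hψ : InducesTransverseFlow φ p e ψ) :
    ∀ᶠ t in 𝓝 (0 : ℝ), ∀ᶠ z in 𝓝 p, (e (φ t z)).1 = ψ t (e z).1 := by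
  rw [InducesTransverseFlow, nhds_prod_eq] at hψ
  exact hψ.curry

theorem InducesTransverseFlow.eventually_eventually_time {φ : Flow ℝ M} {p : M}
    {e : OpenPartialHomeomorph M (FolModel n)} {ψ : ℝ → ℝ → ℝ}
    (hψ : InducesTransverseFlow φ p e ψ) :
    ∀ᶠ z in 𝓝 p, ∀ᶠ t in 𝓝 (0 : ℝ), (e (φ t z)).1 = ψ t (e z).1 := by
  rw [InducesTransverseFlow, nhds_prod_eq] at hψ
  exact (prod_comm (f := 𝓝 (0 : ℝ)) (g := 𝓝 p) ▸ hψ : ∀ᶠ w in map _ _, _).curry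

theorem InducesTransverseFlow.eventually_nhds {φ : Flow ℝ M} {p : M}
    {e : OpenPartialHomeomorph M (FolModel n)} {ψ : ℝ → ℝ → ℝ}
    (hψ : InducesTransverseFlow φ p e ψ) :
    ∀ᶠ q in 𝓝 p, InducesTransverseFlow φ q e ψ := by
  have h : Tendsto (fun q : M => ((0 : ℝ), q)) (𝓝 p) (𝓝 (0, p)) := by
    have : Continuous fun q : M => ((0 : ℝ), q) := by fun_prop
    exact this.tendsto p
  exact h.eventually (eventually_eventually_nhds.2 hψ)

variable [ChartedSpace (EuclideanSpace ℝ (Fin (n + 1))) M] {F : Foliation n M}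

/-- The transverse exponent can be read in any foliated chart. -/
theorem HasTransverseExponent.exists_flow {φ : Flow ℝ M} {p : M} {κ : ℝ}
    (h : F.HasTransverseExponent φ p κ) {e : OpenPartialHomeomorph M (FolModel n)}
    (he : F.IsFoliatedChart e) (hp : p ∈ e.source) :
    ∃ ψ : ℝ → ℝ → ℝ, InducesTransverseFlow φ p e ψ ∧
      ∀ᶠ t in 𝓝 (0 : ℝ), ψ t (e p).1 = (e p).1 ∧
        HasDerivAt (ψ t) (Real.exp (κ * t)) (e p).1 := by
  obtain ⟨e₀, he₀, hp₀, ψ, hψ, hd⟩ := h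
  obtain ⟨f, hf⟩ := he₀.compat he p ⟨hp₀, hp⟩
  obtain ⟨k, hk, hkd, -, hkf⟩ := he₀.exists_transition_inverse he hp₀ hp hf
  refine ⟨_, InducesTransverseFlow.conj hψ hf hk, ?_⟩
  filter_upwards [hd] with t ⟨h0, h1⟩
  have hk0 : k (e p).1 = (e₀ p).1 := hk.self_of_nhds.symm
  refine ⟨by rw [hk0, h0, ← hf.self_of_nhds], ?_⟩
  have hfd := ((he₀.contDiffAt_transition he hp₀ hp hf).differentiableAt (by simp)).hasDerivAt
  have hkd := (hkd.differentiableAt (by simp)).hasDerivAt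
  rw [← hk0] at h1
  have h2 : ψ t (k (e p).1) = (e₀ p).1 := by rw [hk0, h0]
  rw [← h2] at hfd
  -- The new flow is the conjugate `f ∘ ψ t ∘ k`; at the fixed point the derivatives of the mutually
  -- inverse germs `f` and `k` cancel.
  refine (HasDerivAt.comp (e p).1 (h₂ := f) (h := fun x => ψ t (k x)) hfd
    (h1.comp _ hkd)).congr_deriv ?_
  rw [h2]
  linear_combination Real.exp (κ * t) * hkf

/-- In a common chart the germ of the induced map at each small time is determined by the flow,
hence so is its derivative; a single small `t ≠ 0` then separates exponents. -/
theorem HasTransverseExponent.unique {φ : Flow ℝ M} {p : M} {κ κ' : ℝ}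
    (h : F.HasTransverseExponent φ p κ) (h' : F.HasTransverseExponent φ p κ') : κ = κ' := by
  obtain ⟨e, he, hp, ψ, hψ, hd⟩ := h
  obtain ⟨ψ', hψ', hd'⟩ := h'.exists_flow he hp
  have hψ : InducesTransverseFlow φ p e ψ := hψ
  have key : ∀ᶠ t in 𝓝 (0 : ℝ), Real.exp (κ * t) = Real.exp (κ' * t) := by
    filter_upwards [hd, hd', hψ.eventually_eventually, hψ'.eventually_eventually]
      with t h1 h2 h3 h4
    exact (h1.2.congr_of_eventuallyEq (transverse_factor_unique hp h4 h3)).unique h2.2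
  obtain ⟨t, ht, ht0⟩ := ((key.filter_mono nhdsWithin_le_nhds).and
    (self_mem_nhdsWithin (s := {0}ᶜ))).exists
  exact mul_right_cancel₀ ht0 (Real.exp_injective ht)

/-- Nearby points of the path have the same transverse coordinate, so the same chart and the same
`ψ` witness the same exponent. -/
theorem HasTransverseExponent.eventually_path {φ : Flow ℝ M} {p q : M}
    (c : @Path M F.leafTopology p q) {s : unitInterval} {κ : ℝ}
    (h : F.HasTransverseExponent φ (c s) κ) :
    ∀ᶠ s' in 𝓝 s, F.HasTransverseExponent φ (c s') κ := by
  obtain ⟨e, he, hs, ψ, hψ, hd⟩ := h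
  have hψ : InducesTransverseFlow φ (c s) e ψ := hψ
  filter_upwards [eventually_path_mem c s he hs
    (hψ.eventually_nhds.and (e.open_source.mem_nhds hs))] with s' ⟨⟨h1, h2⟩, h3⟩
  exact ⟨e, he, h2, ψ, h1, by rwa [h3]⟩

/-- The transverse exponent is constant along a preserved leaf. -/
theorem IsTransverselySimple.exists_exponent {φ : Flow ℝ M} (hs : F.IsTransverselySimple φ)
    {L : Set M} (hL : F.IsPreservedLeaf φ L) :
    ∃ κ : ℝ, κ ≠ 0 ∧ ∀ p ∈ L, ∀ κ' : ℝ, F.HasTransverseExponent φ p κ' ↔ κ' = κ := by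
  obtain ⟨p₀, hp₀⟩ := hL.1
  have hmem : p₀ ∈ L := by
    rw [hp₀]
    exact @mem_pathComponent_self M F.leafTopology p₀
  obtain ⟨κ, hκ, hκ₀⟩ := hs L hL p₀ hmem
  have hall : ∀ p ∈ L, F.HasTransverseExponent φ p κ := by
    intro p hp
    rw [hp₀] at hp
    obtain ⟨c⟩ : @Joined M F.leafTopology p₀ p := hp
    have := (isPreconnected_univ (α := unitInterval)).iff_of_locally_iff
      (P := fun s => F.HasTransverseExponent φ (c s) κ) (s := 0) (s' := 1) (fun s _ => ?_)
      (mem_univ _) (mem_univ _)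
    · simp only [Path.source, Path.target] at this
      exact this.2 hκ₀
    · rw [nhdsWithin_univ]
      -- Some exponent `κ'` exists at `c s` and persists nearby. By uniqueness, having exponent `κ`
      -- means `κ = κ'` both at `c s` and at these nearby points, so the property is locally
      -- constant rather than merely open.
      obtain ⟨κ', -, hκ'⟩ := hs L hL (c s) (path_mem_leaf hL.1 hmem c s)
      filter_upwards [hκ'.eventually_path c] with s' hs'
      exact ⟨fun h => hs'.unique h ▸ hκ', fun h => hκ'.unique h ▸ hs'⟩
  exact ⟨κ, hκ, fun p hp κ' => ⟨fun h => h.unique (hall p hp), fun h => h ▸ hall p hp⟩⟩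

end Foliation


-- The transverse vector field and its linearization in a foliated chart.

/-- The generator of a local flow on the line has derivative `κ` at a point where the tangent map
of the flow is multiplication by `exp (κ t)`. -/
theorem hasDerivAt_generator {Ψ : ℝ × ℝ → ℝ} {x₀ κ : ℝ} (hΨ : ContDiffAt ℝ ∞ Ψ (0, x₀))
    (hd : ∀ᶠ t in 𝓝 (0 : ℝ), HasDerivAt (fun x => Ψ (t, x)) (Real.exp (κ * t)) x₀) :
    HasDerivAt (fun x => fderiv ℝ Ψ (0, x) (1, 0)) κ x₀ := by
  have hD : HasFDerivAt (fderiv ℝ Ψ) (fderiv ℝ (fderiv ℝ Ψ) (0, x₀)) (0, x₀) :=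
    ((hΨ.fderiv_right (m := ∞) (by simp)).differentiableAt (by simp)).hasFDerivAt
  -- Mixed partials commute: the `x`-derivative of the generator is the time derivative at `0` of
  -- `∂ₓΨ = exp (κ t)`, which is `κ`.
  have hsymm := (hΨ.isSymmSndFDerivAt (by
    simpa using WithTop.coe_le_coe.2 (le_top : (2 : ℕ∞) ≤ ⊤))) (0, 1) (1, 0)
  have hx : HasDerivAt (fun x : ℝ => ((0 : ℝ), x)) (0, 1) x₀ :=
    (hasDerivAt_const _ _).prodMk (hasDerivAt_id _)
  have ht : HasDerivAt (fun t : ℝ => (t, x₀)) (1, 0) (0 : ℝ) :=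
    (hasDerivAt_id _).prodMk (hasDerivAt_const _ _)
  have h1 : HasDerivAt (fun x => fderiv ℝ Ψ (0, x) (1, 0))
      (fderiv ℝ (fderiv ℝ Ψ) (0, x₀) (0, 1) (1, 0)) x₀ :=
    (ContinuousLinearMap.apply ℝ ℝ ((1, 0) : ℝ × ℝ)).hasFDerivAt.comp_hasDerivAt x₀
      (hD.comp_hasDerivAt x₀ hx)
  have h2 : HasDerivAt (fun t => fderiv ℝ Ψ (t, x₀) (0, 1))
      (fderiv ℝ (fderiv ℝ Ψ) (0, x₀) (1, 0) (0, 1)) 0 :=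
    (ContinuousLinearMap.apply ℝ ℝ ((0, 1) : ℝ × ℝ)).hasFDerivAt.comp_hasDerivAt (0 : ℝ)
      (HasFDerivAt.comp_hasDerivAt (0 : ℝ) hD ht)
  have hdiff : ∀ᶠ t in 𝓝 (0 : ℝ), DifferentiableAt ℝ Ψ (t, x₀) := by
    have h3 : ∀ᶠ w in 𝓝 ((0 : ℝ), x₀), DifferentiableAt ℝ Ψ w := by
      filter_upwards [(hΨ.of_le (m := 1) (by exact_mod_cast le_top)).eventually (by simp)]
        with w hw using hw.differentiableAt one_ne_zero
    exact ht.continuousAt.eventually h3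
  have h3 : HasDerivAt (fun t => Real.exp (κ * t)) κ 0 := by
    simpa using ((hasDerivAt_id (0 : ℝ)).const_mul κ).exp
  have h4 : (fun t => fderiv ℝ Ψ (t, x₀) (0, 1)) =ᶠ[𝓝 0] fun t => Real.exp (κ * t) := by
    filter_upwards [hd, hdiff] with t h5 h6
    have hx : HasDerivAt (fun x : ℝ => (t, x)) (0, 1) x₀ :=
      (hasDerivAt_const _ _).prodMk (hasDerivAt_id _)
    exact (h6.hasFDerivAt.comp_hasDerivAt x₀ hx).unique h5
  have h5 := h2.unique (h3.congr_of_eventuallyEq h4)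
  rw [hsymm, h5] at h1
  exact h1

theorem eventually_contDiffAt_generator {Ψ : ℝ × ℝ → ℝ} {x₀ : ℝ}
    (hΨ : ∀ᶠ w in 𝓝 ((0 : ℝ), x₀), ContDiffAt ℝ ∞ Ψ w) :
    ∀ᶠ x in 𝓝 x₀, ContDiffAt ℝ ∞ (fun x => fderiv ℝ Ψ (0, x) (1, 0)) x := by
  have hc : ContinuousAt (fun x : ℝ => ((0 : ℝ), x)) x₀ := by fun_prop
  filter_upwards [hc.eventually hΨ] with x hx
  have h1 : ContDiffAt ℝ ∞ (fun x : ℝ => ((0 : ℝ), x)) x := contDiffAt_const.prodMk contDiffAt_id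
  exact (ContDiffAt.comp x (hx.fderiv_right (m := ∞) (by simp)) h1).clm_apply contDiffAt_const

namespace Foliation

variable {n : ℕ} {M : Type*} [TopologicalSpace M]

/-- The flow read through the transverse coordinate of `e` along the slice through `p`. -/
def sliceFlow (φ : Flow ℝ M) (p : M) (e : OpenPartialHomeomorph M (FolModel n)) (w : ℝ × ℝ) : ℝ :=
  (e (φ w.1 (transverseSlice e p w.2))).1

theorem tendsto_prodMap_transverseSlice {e : OpenPartialHomeomorph M (FolModel n)} {p : M}
    (hp : p ∈ e.source) :
    Tendsto (fun w : ℝ × ℝ => (w.1, transverseSlice e p w.2)) (𝓝 (0, (e p).1)) (𝓝 (0, p)) := by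
  rw [nhds_prod_eq, nhds_prod_eq]
  exact tendsto_id.prodMap (tendsto_transverseSlice hp)

/-- Around `p`, the induced local flow is the flow along the slice through `p`. -/
theorem InducesTransverseFlow.sliceFlow_eq {φ : Flow ℝ M} {p : M}
    {e : OpenPartialHomeomorph M (FolModel n)} {ψ : ℝ → ℝ → ℝ}
    (hψ : InducesTransverseFlow φ p e ψ) (hp : p ∈ e.source) :
    ∀ᶠ w in 𝓝 ((0 : ℝ), (e p).1), sliceFlow φ p e w = ψ w.1 w.2 := by
  have hsnd : Tendsto (fun w : ℝ × ℝ => w.2) (𝓝 (0, (e p).1)) (𝓝 (e p).1) := continuousAt_snd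
  filter_upwards [(tendsto_prodMap_transverseSlice hp).eventually hψ,
    hsnd.eventually (eventually_transverse_slice hp)] with w h1 h2
  rw [sliceFlow, h1, h2]

variable [ChartedSpace (EuclideanSpace ℝ (Fin (n + 1))) M] {F : Foliation n M}

/-- An induced flow `ψ` is a priori an arbitrary function. The flow along a slice represents the
same germ and is smooth as a composite of slice, flow and chart. -/
theorem IsFoliatedFlow.eventually_contDiffAt_sliceFlow {φ : Flow ℝ M} (hφ : F.IsFoliatedFlow φ)
    {p : M} {e : OpenPartialHomeomorph M (FolModel n)} (he : F.IsFoliatedChart e)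
    (hp : p ∈ e.source) :
    ∀ᶠ w in 𝓝 ((0 : ℝ), (e p).1), ContDiffAt ℝ ∞ (sliceFlow φ p e) w := by
  have hsnd : Tendsto (fun w : ℝ × ℝ => w.2) (𝓝 (0, (e p).1)) (𝓝 (e p).1) := continuousAt_snd
  have hs : ∀ᶠ w : ℝ × ℝ in 𝓝 (0, (e p).1), φ w.1 (transverseSlice e p w.2) ∈ e.source :=
    ((tendsto_flow_nhds φ p).comp (tendsto_prodMap_transverseSlice hp)).eventually
      (e.open_source.mem_nhds hp)
  filter_upwards [hs, hsnd.eventually (eventually_slice_mem_target hp)] with w h1 h2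
  have h3 : ContMDiffAt 𝓘(ℝ, ℝ × ℝ) 𝓘(ℝ, ℝ) ∞ (fun w : ℝ × ℝ => w.1) w :=
    contDiffAt_fst.contMDiffAt
  have h4 : ContMDiffAt 𝓘(ℝ, ℝ × ℝ) 𝓘(ℝ, ℝ) ∞ (fun w : ℝ × ℝ => w.2) w :=
    contDiffAt_snd.contMDiffAt
  have h5 : ContMDiffAt 𝓘(ℝ, ℝ × ℝ) (𝓡 (n + 1)) ∞
      (fun w : ℝ × ℝ => transverseSlice e p w.2) w :=
    ContMDiffAt.comp (g := transverseSlice e p) w (he.contMDiffAt_transverseSlice h2) h4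
  have h6 : ContMDiffAt 𝓘(ℝ, ℝ × ℝ) (𝓡 (n + 1)) ∞
      (fun w : ℝ × ℝ => φ w.1 (transverseSlice e p w.2)) w :=
    ContMDiffAt.comp w (hφ.smooth.contMDiffAt (x := (w.1, transverseSlice e p w.2)))
      (h3.prodMk h5)
  exact (ContMDiffAt.comp w (he.contMDiffAt_transverse h1) h6).contDiffAt

/-- Around a point with nonzero transverse exponent, the transverse vector field can be
linearized. -/
theorem HasTransverseExponent.exists_linearizingChart {φ : Flow ℝ M} (hφ : F.IsFoliatedFlow φ)
    {p : M} {κ : ℝ} (hκ : κ ≠ 0) (h : F.HasTransverseExponent φ p κ) :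
    ∃ e : OpenPartialHomeomorph M (FolModel n), F.IsLinearizingChart φ p κ e := by
  obtain ⟨e, he, hp, ψ, hψ, hd⟩ := h
  have hψ : InducesTransverseFlow φ p e ψ := hψ
  have hsl := hψ.sliceFlow_eq hp
  have hsm := hφ.eventually_contDiffAt_sliceFlow he hp
  have hsl' : ∀ᶠ t in 𝓝 (0 : ℝ), ∀ᶠ x in 𝓝 (e p).1, sliceFlow φ p e (t, x) = ψ t x := by
    rw [nhds_prod_eq] at hsl
    exact hsl.curry
  set X : ℝ → ℝ := fun x => fderiv ℝ (sliceFlow φ p e) (0, x) (1, 0) with hX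
  have hXt : ∀ x, DifferentiableAt ℝ (sliceFlow φ p e) (0, x) →
      HasDerivAt (fun t => sliceFlow φ p e (t, x)) (X x) 0 := fun x hx => by
    have ht : HasDerivAt (fun t : ℝ => (t, x)) (1, 0) (0 : ℝ) :=
      (hasDerivAt_id _).prodMk (hasDerivAt_const _ _)
    exact HasFDerivAt.comp_hasDerivAt (0 : ℝ) hx.hasFDerivAt ht
  have hX0 : X (e p).1 = 0 := by
    refine (hXt _ (hsm.self_of_nhds.differentiableAt (by simp))).unique
      ((hasDerivAt_const _ (e p).1).congr_of_eventuallyEq ?_)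
    filter_upwards [hd, hsl'] with t h1 h2
    rw [h2.self_of_nhds, h1.1]
  have hXd : HasDerivAt X κ (e p).1 := by
    refine hasDerivAt_generator hsm.self_of_nhds ?_
    filter_upwards [hd, hsl'] with t h1 h2
    exact h1.2.congr_of_eventuallyEq h2
  obtain ⟨u, hu, hu0, hud, hueq⟩ :=
    exists_linearizing_coordinate (eventually_contDiffAt_generator hsm) hX0 hXd hκ
  obtain ⟨v, hpv, hvu, hv, hv'⟩ := exists_smooth_openPartialHomeomorph hu hud
  have hc : ContinuousAt (fun x : ℝ => ((0 : ℝ), x)) (e p).1 := by fun_prop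
  have hsl'' : ∀ᶠ x in 𝓝 (e p).1, ∀ᶠ t in 𝓝 (0 : ℝ), sliceFlow φ p e (t, x) = ψ t x := by
    filter_upwards [hc.eventually (eventually_eventually_nhds.2 hsl)] with x hx
    have ht : ContinuousAt (fun t : ℝ => (t, x)) 0 := by fun_prop
    exact ht.eventually hx
  -- The equation on the line is lifted to all points near `p`, including those off the slice,
  -- because the transverse coordinate of `φ t z` depends only on `t` and that of `z`.
  have hfield : ∀ᶠ z in 𝓝 p, HasDerivAt (fun t => u (e (φ t z)).1) (κ * u (e z).1) 0 := by
    filter_upwards [hψ.eventually_eventually_time, (tendsto_transverse hp).eventually hueq,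
      (tendsto_transverse hp).eventually hsl'',
      (tendsto_transverse hp).eventually (hc.eventually hsm)] with z h1 h2 h3 h4
    have h5 : HasDerivAt (fun t => (e (φ t z)).1) (X (e z).1) 0 := by
      refine (hXt _ (h4.differentiableAt (by simp))).congr_of_eventuallyEq ?_
      filter_upwards [h1, h3] with t h6 h7
      rw [h6, h7]
    have h0 : (e (φ 0 z)).1 = (e z).1 := by rw [φ.map_zero_apply]
    have h6 : HasDerivAt u (deriv u (e z).1) (e (φ 0 z)).1 := by
      rw [h0]
      exact (hu.differentiable (by simp) _).hasDerivAt
    exact (HasDerivAt.comp (0 : ℝ) h6 h5).congr_deriv h2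
  obtain ⟨e', he', hp', hsub, hee'⟩ := he.exists_reparam hp hpv hv hv' hfield
  refine ⟨e', he', hp', by rw [hee' p hp', hvu, hu0], fun z hz => ?_⟩
  have h1 : HasDerivAt (fun t => u (e (φ t z)).1) (κ * u (e z).1) 0 := (hsub hz).1
  rw [hee' z hz, hvu]
  refine h1.congr_of_eventuallyEq ?_
  filter_upwards [(tendsto_flow_time φ z).eventually (e'.open_source.mem_nhds hz)] with t ht
  rw [hee' _ ht, hvu]

end Foliation


-- Continuation of oriented eigenfunctions along leafwise paths, and holonomy.

namespace Foliation

variable {n : ℕ} {M : Type*} [TopologicalSpace M]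

/-- Around `q`, the function `f` is an eigenfunction of the infinitesimal generator of `φ`, with
eigenvalue `κ`. -/
def IsEigenfunctionAt (φ : Flow ℝ M) (κ : ℝ) (f : M → ℝ) (q : M) : Prop :=
  ∀ᶠ z in 𝓝 q, HasDerivAt (fun t : ℝ => f (φ t z)) (κ * f z) 0

/-- Around `q`, the function `f` factors through the transverse coordinate of some chart in `A`,
by a function whose derivative has the sign of `ε`. -/
def HasOrientationAt (A : Set (OpenPartialHomeomorph M (FolModel n))) (ε : ℝ) (f : M → ℝ)
    (q : M) : Prop :=
  ∃ a ∈ A, q ∈ a.source ∧ ∃ η : ℝ → ℝ, (∀ᶠ z in 𝓝 q, f z = η (a z).1) ∧ 0 < ε * deriv η (a q).1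

/-- Any two charts in `A` define the same transverse orientation. -/
def CoherentlyOriented (A : Set (OpenPartialHomeomorph M (FolModel n))) : Prop :=
  ∀ e ∈ A, ∀ e' ∈ A, ∀ q ∈ e.source ∩ e'.source,
    ∃ h : ℝ → ℝ, (∀ᶠ z in 𝓝 q, (e' z).1 = h (e z).1) ∧ 0 < deriv h (e q).1

theorem IsEigenfunctionAt.congr {φ : Flow ℝ M} {κ : ℝ} {f g : M → ℝ} {q : M}
    (hf : IsEigenfunctionAt φ κ f q) (h : f =ᶠ[𝓝 q] g) : IsEigenfunctionAt φ κ g q := by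
  filter_upwards [hf, h, eventually_eventually_nhds.2 h] with z h1 h2 h3
  rw [← h2]
  refine h1.congr_of_eventuallyEq ?_
  filter_upwards [(tendsto_flow_time φ z).eventually h3] with t ht
  exact ht.symm

theorem HasOrientationAt.congr {A : Set (OpenPartialHomeomorph M (FolModel n))} {ε : ℝ}
    {f g : M → ℝ} {q : M} (hf : HasOrientationAt A ε f q) (h : f =ᶠ[𝓝 q] g) :
    HasOrientationAt A ε g q := by
  obtain ⟨a, ha, hq, η, hη, hd⟩ := hf
  refine ⟨a, ha, hq, η, ?_, hd⟩
  filter_upwards [hη, h] with z h1 h2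
  rw [← h2, h1]

/-- For a function of the transverse coordinate, being an eigenfunction is locally constant along
the plaques. -/
theorem InducesTransverseFlow.eventually_isEigenfunctionAt_iff {φ : Flow ℝ M} {q : M}
    {k : OpenPartialHomeomorph M (FolModel n)} {ψ : ℝ → ℝ → ℝ}
    (hψ : InducesTransverseFlow φ q k ψ) (hq : q ∈ k.source) (κ : ℝ) (H : ℝ → ℝ) :
    ∀ᶠ q' in 𝓝 q, (k q').1 = (k q).1 →
      (IsEigenfunctionAt φ κ (fun z => H (k z).1) q' ↔
        IsEigenfunctionAt φ κ (fun z => H (k z).1) q) := by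
  have hR : ∀ᶠ z in 𝓝 q, HasDerivAt (fun t : ℝ => H (k (φ t z)).1) (κ * H (k z).1) 0 ↔
      HasDerivAt (fun t : ℝ => H (ψ t (k z).1)) (κ * H (k z).1) 0 := by
    filter_upwards [hψ.eventually_eventually_time] with z hz
    refine Filter.EventuallyEq.hasDerivAt_iff ?_
    filter_upwards [hz] with t ht
    rw [ht]
  -- Once the flow is replaced by `ψ`, the condition concerns only germs at `(k q').1` on the line,
  -- so it takes the same value at points of one plaque.
  have hiff : ∀ q', q' ∈ k.source → (∀ᶠ z in 𝓝 q',
      HasDerivAt (fun t : ℝ => H (k (φ t z)).1) (κ * H (k z).1) 0 ↔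
        HasDerivAt (fun t : ℝ => H (ψ t (k z).1)) (κ * H (k z).1) 0) →
      (IsEigenfunctionAt φ κ (fun z => H (k z).1) q' ↔
        ∀ᶠ x in 𝓝 (k q').1, HasDerivAt (fun t : ℝ => H (ψ t x)) (κ * H x) 0) := fun q' hq' h => by
    rw [← eventually_transverse_iff hq']
    exact eventually_congr h
  filter_upwards [eventually_eventually_nhds.2 hR, k.open_source.mem_nhds hq] with q' h1 h2 h3
  rw [hiff q' h2 h1, hiff q hq hR, h3]

/-- Changing charts within `A` multiplies the derivative by a positive number, so the sign may be
tested in any one chart of `A`. -/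
theorem CoherentlyOriented.hasOrientationAt_iff
    {A : Set (OpenPartialHomeomorph M (FolModel n))} (hA : CoherentlyOriented A) {ε : ℝ}
    {f : M → ℝ} {q : M} {a : OpenPartialHomeomorph M (FolModel n)} (ha : a ∈ A)
    (hq : q ∈ a.source) {η : ℝ → ℝ} (hη : ∀ᶠ z in 𝓝 q, f z = η (a z).1) :
    HasOrientationAt A ε f q ↔ 0 < ε * deriv η (a q).1 := by
  refine ⟨?_, fun h => ⟨a, ha, hq, η, hη, h⟩⟩
  rintro ⟨a', ha', hq', η', hη', hd⟩
  obtain ⟨h, hh, hhd⟩ := hA a ha a' ha' q ⟨hq, hq'⟩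
  have heq : η =ᶠ[𝓝 (a q).1] η' ∘ h := by
    refine transverse_factor_unique hq hη ?_
    filter_upwards [hη', hh] with z h1 h2
    rw [h1, h2, Function.comp_apply]
  -- Since `deriv` is `0` where a function is not differentiable, a nonzero value already supplies
  -- the differentiability needed for the chain rule.
  have hd0 : deriv η' (a' q).1 ≠ 0 := fun h0 => by simp [h0] at hd
  rw [hh.self_of_nhds] at hd hd0
  rw [heq.deriv_eq, deriv_comp _ (differentiableAt_of_deriv_ne_zero hd0)
    (differentiableAt_of_deriv_ne_zero hhd.ne'), ← mul_assoc]
  exact mul_pos hd hhd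

variable [ChartedSpace (EuclideanSpace ℝ (Fin (n + 1))) M] {F : Foliation n M}

/-- For a function of the transverse coordinate, the orientation is locally constant along the
plaques. -/
theorem CoherentlyOriented.eventually_hasOrientationAt_iff
    {A : Set (OpenPartialHomeomorph M (FolModel n))} (hA : CoherentlyOriented A)
    (hAF : ∀ e ∈ A, F.IsFoliatedChart e) (hcov : ∀ p : M, ∃ e ∈ A, p ∈ e.source) {q : M}
    {k : OpenPartialHomeomorph M (FolModel n)} (hk : F.IsFoliatedChart k) (hq : q ∈ k.source)
    (ε : ℝ) (H : ℝ → ℝ) :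
    ∀ᶠ q' in 𝓝 q, (k q').1 = (k q).1 →
      (HasOrientationAt A ε (fun z => H (k z).1) q' ↔
        HasOrientationAt A ε (fun z => H (k z).1) q) := by
  obtain ⟨a, ha, hqa⟩ := hcov q
  obtain ⟨j, hj⟩ := hk.compat (hAF a ha) q ⟨hq, hqa⟩
  obtain ⟨l, hl⟩ := (hAF a ha).compat hk q ⟨hqa, hq⟩
  have hη : ∀ᶠ z in 𝓝 q, H (k z).1 = (H ∘ l) (a z).1 := by
    filter_upwards [hl] with z hz
    rw [hz, Function.comp_apply]
  filter_upwards [hj, eventually_eventually_nhds.2 hη, a.open_source.mem_nhds hqa]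
    with q' h1 h2 h3 h4
  rw [hA.hasOrientationAt_iff ha h3 h2, hA.hasOrientationAt_iff ha hqa hη, h1, h4,
    ← hj.self_of_nhds]

/-- Transport of a function of the transverse coordinate along a path in a leaf, within a chart. -/
theorem transport_in_chart {φ : Flow ℝ M}
    {A : Set (OpenPartialHomeomorph M (FolModel n))} (hA : CoherentlyOriented A)
    (hAF : ∀ e ∈ A, F.IsFoliatedChart e) (hcov : ∀ p : M, ∃ e ∈ A, p ∈ e.source)
    {p q : M} (c : @Path M F.leafTopology p q) {k : OpenPartialHomeomorph M (FolModel n)}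
    (hk : F.IsFoliatedChart k) {s₀ s₁ : unitInterval} (hs : s₀ ≤ s₁)
    (hc : ∀ s ∈ Icc s₀ s₁, c s ∈ k.source)
    (hflow : ∀ s ∈ Icc s₀ s₁, ∃ ψ, InducesTransverseFlow φ (c s) k ψ) (κ ε : ℝ) (H : ℝ → ℝ) :
    (k (c s₁)).1 = (k (c s₀)).1 ∧
    (IsEigenfunctionAt φ κ (fun z => H (k z).1) (c s₀) →
      IsEigenfunctionAt φ κ (fun z => H (k z).1) (c s₁)) ∧
    (HasOrientationAt A ε (fun z => H (k z).1) (c s₀) →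
      HasOrientationAt A ε (fun z => H (k z).1) (c s₁)) := by
  have hI : IsPreconnected (Icc s₀ s₁) := isPreconnected_Icc
  have h₀ : s₀ ∈ Icc s₀ s₁ := ⟨le_rfl, hs⟩
  have h₁ : s₁ ∈ Icc s₀ s₁ := ⟨hs, le_rfl⟩
  refine ⟨?_, ?_, ?_⟩
  · refine (hI.iff_of_locally_iff (P := fun s => (k (c s)).1 = (k (c s₀)).1)
      (fun s hs => ?_) h₀ h₁).2 rfl
    filter_upwards [nhdsWithin_le_nhds (eventually_path_mem c s hk (hc s hs)
      (Eventually.of_forall fun _ => trivial))] with s' h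
    rw [h.2]
  · refine (hI.iff_of_locally_iff
      (P := fun s => IsEigenfunctionAt φ κ (fun z => H (k z).1) (c s)) (fun s hs => ?_) h₀ h₁).2
    obtain ⟨ψ, hψ⟩ := hflow s hs
    filter_upwards [nhdsWithin_le_nhds (eventually_path_mem c s hk (hc s hs)
      (hψ.eventually_isEigenfunctionAt_iff (hc s hs) κ H))] with s' h
    exact h.1 h.2
  · refine (hI.iff_of_locally_iff
      (P := fun s => HasOrientationAt A ε (fun z => H (k z).1) (c s)) (fun s hs => ?_) h₀ h₁).2
    filter_upwards [nhdsWithin_le_nhds (eventually_path_mem c s hk (hc s hs)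
      (hA.eventually_hasOrientationAt_iff hAF hcov hk (hc s hs) ε H))] with s' h
    exact h.1 h.2

/-- Along the holonomy `γ` of a path, the transverse coordinate is transported to a function `H` of
the transverse coordinate which is a left inverse of `γ`, and which keeps being an oriented
eigenfunction. -/
theorem IsHolonomy.exists_transport {φ : Flow ℝ M}
    {A : Set (OpenPartialHomeomorph M (FolModel n))} (hA : CoherentlyOriented A)
    (hAF : ∀ e ∈ A, F.IsFoliatedChart e) (hcov : ∀ p : M, ∃ e ∈ A, p ∈ e.source)
    {p q : M} {c : @Path M F.leafTopology p q} {e e' : OpenPartialHomeomorph M (FolModel n)}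
    {γ : Germ (𝓝 (e p).1) ℝ} (hγ : F.IsHolonomy c e e' γ)
    (hflow : ∀ s, ∀ k, F.IsFoliatedChart k → c s ∈ k.source →
      ∃ ψ, InducesTransverseFlow φ (c s) k ψ) {κ ε : ℝ}
    (hκ : IsEigenfunctionAt φ κ (fun z => (e z).1) p)
    (hε : HasOrientationAt A ε (fun z => (e z).1) p) :
    ∃ G H : ℝ → ℝ, γ = (G : Germ (𝓝 (e p).1) ℝ) ∧ Tendsto G (𝓝 (e p).1) (𝓝 (e' q).1) ∧
      ContDiffAt ℝ ∞ H (e' q).1 ∧ (∀ᶠ x in 𝓝 (e p).1, H (G x) = x) ∧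
      IsEigenfunctionAt φ κ (fun z => H (e' z).1) q ∧
      HasOrientationAt A ε (fun z => H (e' z).1) q := by
  obtain ⟨m, t, k, g, ht0, ht1, htm, hk0, hkm, hkF, hck, hg, rfl⟩ := hγ
  have hle : ∀ i ≤ m, t i ≤ t (i + 1) := fun i hi =>
    (htm (mem_Iic.2 (by omega)) (mem_Iic.2 (by omega)) (Nat.lt_succ_self i)).le
  have hp : c (t 0) = p := by rw [ht0]; exact @Path.source M F.leafTopology p q c
  have hq : c (t (m + 1)) = q := by rw [ht1]; exact @Path.target M F.leafTopology p q c
  -- Stage `i` is stated at `c (t (i + 1))`, the end of the segment lying in `k i`: the transverse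
  -- coordinate of `k i` is constant on that segment, and the next change of chart takes place
  -- there.
  have key : ∀ i ≤ m, ∃ H : ℝ → ℝ,
      Tendsto (chainComp g i) (𝓝 (e p).1) (𝓝 (k i (c (t (i + 1)))).1) ∧
      ContDiffAt ℝ ∞ H (k i (c (t (i + 1)))).1 ∧
      (∀ᶠ x in 𝓝 (e p).1, H (chainComp g i x) = x) ∧
      IsEigenfunctionAt φ κ (fun z => H (k i z).1) (c (t (i + 1))) ∧
      HasOrientationAt A ε (fun z => H (k i z).1) (c (t (i + 1))) := by
    intro i
    induction i with
    | zero =>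
      intro hi
      obtain ⟨h1, h2, h3⟩ := transport_in_chart hA hAF hcov c (hkF 0 hi) (hle 0 hi) (hck 0 hi)
        (fun s hs => hflow s _ (hkF 0 hi) (hck 0 hi s hs)) κ ε id
      rw [h1, hp, hk0]
      rw [hk0, hp] at h2 h3
      exact ⟨id, tendsto_id, contDiffAt_id, Eventually.of_forall fun _ => rfl, h2 hκ, h3 hε⟩
    | succ i ih =>
      intro hi
      obtain ⟨H, hG, hH, hHG, hHκ, hHε⟩ := ih (by omega)
      have hi' : i ≤ m := by omega
      have hm : c (t (i + 1)) ∈ (k i).source := hck i hi' _ ⟨hle i hi', le_rfl⟩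
      have hm' : c (t (i + 1)) ∈ (k (i + 1)).source := hck _ hi _ ⟨le_rfl, hle _ hi⟩
      have hgi := hg i (by omega)
      obtain ⟨l, hl, hld, hlg, -⟩ :=
        (hkF i hi').exists_transition_inverse (hkF _ hi) hm hm' hgi
      obtain ⟨h1, h2, h3⟩ := transport_in_chart hA hAF hcov c (hkF _ hi) (hle _ hi) (hck _ hi)
        (fun s hs => hflow s _ (hkF _ hi) (hck _ hi s hs)) κ ε (H ∘ l)
      have hfe : (fun z => H (k i z).1) =ᶠ[𝓝 (c (t (i + 1)))]
          fun z => (H ∘ l) (k (i + 1) z).1 := by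
        filter_upwards [hl] with z hz
        rw [hz, Function.comp_apply]
      have hgc : Tendsto (g i) (𝓝 (k i (c (t (i + 1)))).1) (𝓝 (k (i + 1) (c (t (i + 1)))).1) := by
        rw [hgi.self_of_nhds]
        exact ((hkF i hi').contDiffAt_transition (hkF _ hi) hm hm' hgi).continuousAt
      -- `l` is the local inverse of `g i`: rewriting the same function in the next chart
      -- precomposes `H` with `l`, while the holonomy is postcomposed with `g i`, so the
      -- left-inverse relation is kept.
      refine ⟨H ∘ l, ?_, ?_, ?_, h2 (hHκ.congr hfe), h3 (hHε.congr hfe)⟩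
      · rw [h1]
        exact hgc.comp hG
      · rw [h1]
        rw [hl.self_of_nhds] at hH
        exact hH.comp _ hld
      · filter_upwards [hHG, hG.eventually hlg] with x hx hx'
        simp only [chainComp, Function.comp_apply, hx', hx]
  obtain ⟨H, h1, h2, h3, h4, h5⟩ := key m le_rfl
  rw [hq, hkm] at h1 h2 h4 h5
  exact ⟨_, H, rfl, h1, h2, h3, h4, h5⟩

/-- In a chart linearizing the transverse vector field, the holonomy along loops is given by
homotheties. -/
theorem IsLinearizingChart.holonomy_eq {φ : Flow ℝ M} (hF : F.IsTransverselyOrientable) {p : M}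
    {κ : ℝ} (hκ : κ ≠ 0) {e : OpenPartialHomeomorph M (FolModel n)}
    (he : F.IsLinearizingChart φ p κ e) {c : @Path M F.leafTopology p p}
    (hflow : ∀ s, ∀ k, F.IsFoliatedChart k → c s ∈ k.source →
      ∃ ψ, InducesTransverseFlow φ (c s) k ψ)
    {γ : Germ (𝓝 (e p).1) ℝ} (hγ : F.IsHolonomy c e e γ) :
    ∃ a : ℝ, 0 < a ∧ γ = ((fun x : ℝ => a * x : ℝ → ℝ) : Germ (𝓝 (e p).1) ℝ) := by
  obtain ⟨A, hAF, hcov, hA⟩ := hF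
  have hA : CoherentlyOriented A := hA
  have hp := he.mem_source
  obtain ⟨a, ha, hpa⟩ := hcov p
  obtain ⟨η, hη⟩ := (hAF a ha).compat he.foliated p ⟨hpa, hp⟩
  obtain ⟨l, -, -, -, hlη⟩ := (hAF a ha).exists_transition_inverse he.foliated hpa hp hη
  have hη0 : deriv η (a p).1 ≠ 0 := right_ne_zero_of_mul (hlη ▸ one_ne_zero)
  have hηd := differentiableAt_of_deriv_ne_zero hη0
  have hfield : IsEigenfunctionAt φ κ (fun z => (e z).1) p := by
    filter_upwards [e.open_source.mem_nhds hp] with z hz using he.field z hz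
  -- Taking `ε` to be the derivative of `e` with respect to a chart of `A` covers both possible
  -- orientations of `e`: the initial sign is that of a nonzero square.
  obtain ⟨G, H, rfl, hG, hH, hHG, hHκ, hHε⟩ := hγ.exists_transport hA hAF hcov hflow hfield
    (ε := deriv η (a p).1) ((hA.hasOrientationAt_iff ha hpa hη).2 (mul_self_pos.2 hη0))
  have hdiff : ∀ᶠ x in 𝓝 (e p).1, DifferentiableAt ℝ H x := by
    filter_upwards [(hH.of_le (m := 1) (by exact_mod_cast le_top)).eventually (by simp)] with x hx
    exact hx.differentiableAt one_ne_zero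
  -- Computing `Z (H(x))` by the chain rule gives `H'(x) κ x`, and the transported equation gives `κ
  -- H(x)`; then `κ ≠ 0` is cancelled.
  have hode : ∀ᶠ x in 𝓝 (e p).1, deriv H x * x = H x := by
    refine (eventually_transverse_iff hp).1 ?_
    filter_upwards [hHκ, hfield, (tendsto_transverse hp).eventually hdiff] with z h1 h2 h3
    have h0 : (e (φ 0 z)).1 = (e z).1 := by rw [φ.map_zero_apply]
    have h4 : HasDerivAt H (deriv H (e z).1) (e (φ 0 z)).1 := by
      rw [h0]
      exact h3.hasDerivAt
    have h5 := (HasDerivAt.comp (0 : ℝ) h4 h2).unique h1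
    exact mul_left_cancel₀ hκ (by linear_combination h5)
  have hlin : ∀ᶠ x in 𝓝 (e p).1, H x = deriv H 0 * x := by
    rw [he.map_zero] at hode hH ⊢
    exact eventually_eq_mul_of_mul_deriv_eq hH hode
  have hb : 0 < deriv H 0 := by
    have h1 : ∀ᶠ z in 𝓝 p, H (e z).1 = (fun x => deriv H 0 * η x) (a z).1 := by
      filter_upwards [(tendsto_transverse hp).eventually hlin, hη] with z h2 h3
      rw [h2, h3]
    have h2 := (hA.hasOrientationAt_iff ha hpa (η := fun x => deriv H 0 * η x) h1).1 hHε
    rw [deriv_const_mul _ hηd] at h2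
    have h3 : 0 < deriv η (a p).1 * deriv η (a p).1 := mul_self_pos.2 hη0
    nlinarith
  -- Linearity of `H` at the point `G x`, combined with `H (G x) = x`, solves for `G x`.
  refine ⟨(deriv H 0)⁻¹, inv_pos.2 hb, Germ.coe_eq.2 ?_⟩
  filter_upwards [hHG, hG.eventually hlin] with x h1 h2
  rw [h1] at h2
  rw [eq_inv_mul_iff_mul_eq₀ hb.ne', ← h2]

end Foliation

end

theorem propositionp {n : ℕ} {M : Type*} [TopologicalSpace M] [T2Space M]
    [SecondCountableTopology M] [ChartedSpace (EuclideanSpace ℝ (Fin (n + 1))) M]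
    [IsManifold (𝓡 (n + 1)) ∞ M] (F : Foliation n M) (hF : F.IsTransverselyOrientable)
    (φ : Flow ℝ M) (hφ : F.IsFoliatedFlow φ) (hs : F.IsTransverselySimple φ)
    (L : Set M) (hL : F.IsPreservedLeaf φ L) :
    ∃ κ : ℝ, κ ≠ 0 ∧
      (∀ p ∈ L, ∀ κ' : ℝ, F.HasTransverseExponent φ p κ' ↔ κ' = κ) ∧
      ∀ p ∈ L,
        (∃ e : OpenPartialHomeomorph M (FolModel n), F.IsLinearizingChart φ p κ e) ∧
        ∀ e : OpenPartialHomeomorph M (FolModel n), F.IsLinearizingChart φ p κ e →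
          ∀ γ ∈ F.holonomyGroup e p, ∃ a : ℝ, 0 < a ∧
            γ = ((fun x : ℝ => a * x : ℝ → ℝ) : Germ (𝓝 (e p).1) ℝ) := by
  obtain ⟨κ, hκ, hall⟩ := hs.exists_exponent hL
  refine ⟨κ, hκ, hall, fun p hp =>
    ⟨((hall p hp κ).2 rfl).exists_linearizingChart hφ hκ, fun e he γ hγ => ?_⟩⟩
  obtain ⟨c, hc⟩ := hγ
  -- The whole loop stays in `L`, where the exponent at each point provides an induced local flow in
  -- every foliated chart containing it.
  refine he.holonomy_eq hF hκ (c := c) (fun s k hk hks => ?_) hc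
  obtain ⟨ψ, hψ, -⟩ := ((hall _ (Foliation.path_mem_leaf hL.1 hp c s) κ).2 rfl).exists_flow hk hks
  exact ⟨ψ, hψ⟩
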